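/- \textbf{Setting.} Let $m\ge 0$, $N,N'\ge 1$ be integers, $X\in\mathbb{R}^{m\times N}$ with columns $X_1,\dots,X_N$, $W\in\mathbb{R}^{N\times N'}$, $\delta>0$ and $\lambda>0$. For $z\in\mathbb{R}$ let $\mathcal{Q}_{\mathrm{stoc}}(z)$ be the random element of the infinite alphabet $\mathcal{A}^\delta=\{k\delta:k\in\mathbb{Z}\}$ that equals $\lfloor z/\delta\rfloor\delta$ with probability $1-\frac z\delta+\lfloor\frac z\delta\rfloor$ and $(\lfloor z/\delta\rfloor+1)\delta$ otherwise (so $\mathbb{E}\,\mathcal{Q}_{\mathrm{stoc}}(z)=z$). OPTQ with stochastic rounding and regularization parameter $\lambda$ takes the Cholesky decomposition $(X^\top X+\lambda I)^{-1}=LL^\top$ ($L$ lower triangular with positive diagonal) and processes every column $w$ of $W$ as follows: put $w^{(0)}=w$ and, for $t=1,\dots,N$, \[ q_t=\mathcal{Q}_{\mathrm{stoc}}\bigl(w^{(t-1)}_t\bigr),\qquad w^{(t)}_{i}=w^{(t-1)}_{i}+\bigl(q_t-w^{(t-1)}_t\bigr)\frac{L_{i,t}}{L_{t,t}}\quad (i\ge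 t+1), \] all roundings (over all steps and all columns) being made with independent randomness. The output for the column $w$ is $q=(q_1,\dots,q_N)^\top$, and $Q\in(\mathcal{A}^\delta)^{N\times N'}$ is the matrix of the outputs for all columns of $W$. Let \[ C_\infty(X,\lambda)^2=\max\Bigl\{\max_{1\le j\le N-m}\frac{\lambda\|X_j\|_2^2}{(\sigma^{(j)}_{\min})^2+\lambda},\ \max_{j>N-m,\ 1\le j\le N}\|X_j\|_2^2\Bigr\}+\lambda,\qquad C_\infty(X,\lambda)\ge 0, \] where a maximum over an empty index set is omitted and $\sigma^{(j)}_{\min}$ is the smallest (possibly zero) of the $\min(m,N-j)$ singular values of the $m\times(N-j)$ matrix $X_{\ge j+1}=(X_{j+1},\dots,X_N)$ (when $m=0$, all $\|X_j\|_2$ vanish and $C_\infty(X,\lambda)^2=\lambda$). \textbf{Theorem.} Let $p,p'>0$. For every column $w$ of $W$ with quantized version $q$, with probability at least $1-\frac{\sqrt2\,(m+N)}{N^p}$ both \[ \|Xw-Xq\|_\infty\le\delta\sqrt{2\pi p\log N}\cdot C_\infty(X,\lambda) \quad\text{and}\quad \|w-q\|_\infty\le\delta\sqrt{2\pi p\log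 N}\cdot\frac{C_\infty(X,\lambda)}{\sqrt\lambda}. \] Moreover, with probability at least $1-\frac{\sqrt2\,(m+N)}{N^p{N'}^{p'-1}}$ both \[ \max_{i,j}|(XW-XQ)_{ij}|\le\delta\sqrt{2\pi(p\log N+p'\log N')}\cdot C_\infty(X,\lambda) \] and \[ \max_{i,j}|(W-Q)_{ij}|\le\delta\sqrt{2\pi(p\log N+p'\log N')}\cdot\frac{C_\infty(X,\lambda)}{\sqrt\lambda}. \] -/

import Mathlib

open Matrix MeasureTheory

namespace OPTQ

noncomputable section

/-! ### Unbiased stochastic rounding -/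

/-- The probability `p = 1 - z/δ + ⌊z/δ⌋` with which the number `z` is rounded down. -/
def roundDownProb (δ z : ℝ) : ℝ := 1 - z / δ + ⌊z / δ⌋

lemma roundDownProb_nonneg (δ z : ℝ) : 0 ≤ roundDownProb δ z := by
  have := Int.lt_floor_add_one (z / δ)
  unfold roundDownProb; linarith

lemma roundDownProb_le_one (δ z : ℝ) : roundDownProb δ z ≤ 1 := by
  have := Int.floor_le (z / δ)
  unfold roundDownProb; linarith

/-- The coin that decides the direction of rounding: `true` means rounding down. -/
def roundCoin (δ z : ℝ) : PMF Bool :=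
  PMF.ofFintype
    (fun b => cond b (ENNReal.ofReal (roundDownProb δ z)) (ENNReal.ofReal (1 - roundDownProb δ z)))
    (by
      have h0 := roundDownProb_nonneg δ z
      have h1 := roundDownProb_le_one δ z
      rw [Fintype.sum_bool, cond_true, cond_false, ← ENNReal.ofReal_add h0 (by linarith)]
      simp)

/-- The unbiased stochastic scalar quantizer for the infinite alphabet `{k δ : k ∈ ℤ}`: the law of
the random number that is `⌊z/δ⌋ δ` with probability `p = 1 - z/δ + ⌊z/δ⌋` and `(⌊z/δ⌋ + 1) δ` with
probability `1 - p`. -/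
def stochRound (δ z : ℝ) : PMF ℝ :=
  (roundCoin δ z).map fun b => cond b (⌊z / δ⌋ * δ) ((⌊z / δ⌋ + 1) * δ)

/-! ### The Cholesky factor -/

/-- `A = L Lᵀ` with `L` lower triangular with positive diagonal entries. -/
structure IsCholesky {N : ℕ} (A L : Matrix (Fin N) (Fin N) ℝ) : Prop where
  lower : ∀ i j, i < j → L i j = 0
  diag_pos : ∀ i, 0 < L i i
  mul_transpose : L * Lᵀ = A

open Classical in
/-- The Cholesky factor of a positive definite matrix `A` (and `0` if `A` has none). -/
def choleskyFactor {N : ℕ} (A : Matrix (Fin N) (Fin N) ℝ) : Matrix (Fin N) (Fin N) ℝ :=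
  if h : ∃ L, IsCholesky A L then h.choose else 0

lemma exists_isCholesky {N : ℕ} {A : Matrix (Fin N) (Fin N) ℝ} (hA : A.PosDef) :
    ∃ L, IsCholesky A L := by
  have hdiag := LDL.diag_eq_lowerInv_conj hA
  have hlow := LDL.lower_conj_diag hA
  have hinv : IsUnit (LDL.lowerInv hA) := isUnit_of_invertible _
  have hD : (LDL.diag hA).PosDef := by
    rw [hdiag]
    refine hA.mul_mul_conjTranspose_same ?_
    exact vecMul_injective_of_isUnit hinv
  have hd : ∀ i, 0 < LDL.diagEntries hA i := posDef_diagonal_iff.1 hD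
  have htri : BlockTriangular (LDL.lowerInv hA) OrderDual.toDual :=
    fun _ _ hij => LDL.lowerInv_triangular hA hij
  have htri' : BlockTriangular (LDL.lower hA) OrderDual.toDual :=
    blockTriangular_inv_of_blockTriangular htri
  set M := LDL.lower hA with hM
  have hMu : M.det ≠ 0 := by
    have : IsUnit M := (Matrix.isUnit_nonsing_inv_iff).2 hinv
    exact ((Matrix.isUnit_iff_isUnit_det _).1 this).ne_zero
  have hMii : ∀ i, M i i ≠ 0 := by
    rw [det_of_isLowerTriangular M htri'] at hMu
    exact fun i => Finset.prod_ne_zero_iff.1 hMu i (Finset.mem_univ i)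
  refine ⟨M * diagonal (fun i => SignType.sign (M i i) * √(LDL.diagEntries hA i)), ?_, ?_, ?_⟩
  · intro i j hij
    rw [mul_diagonal, htri' hij, zero_mul]
  · intro i
    rw [mul_diagonal, ← mul_assoc, self_mul_sign]
    exact mul_pos (abs_pos.2 (hMii i)) (Real.sqrt_pos.2 (hd i))
  · rw [transpose_mul, diagonal_transpose, ← Matrix.mul_assoc, Matrix.mul_assoc M,
      diagonal_mul_diagonal]
    rw [conjTranspose_eq_transpose_of_trivial, LDL.diag] at hlow
    refine Eq.trans ?_ hlow
    congr 3
    ext i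
    have h1 : ((SignType.sign (M i i) : SignType) : ℝ) * (SignType.sign (M i i) : SignType) = 1 := by
      rcases lt_or_gt_of_ne (hMii i) with h | h <;> simp [h]
    rw [mul_mul_mul_comm, h1, one_mul, Real.mul_self_sqrt (hd i).le]

/-- Every positive definite matrix has a Cholesky factor, so the value `0` is never used below. -/
lemma choleskyFactor_spec {N : ℕ} {A : Matrix (Fin N) (Fin N) ℝ} (hA : A.PosDef) :
    IsCholesky A (choleskyFactor A) := by
  have h := exists_isCholesky hA
  rw [choleskyFactor, dif_pos h]
  exact h.choose_spec

lemma hessian_posDef {m N : ℕ} (X : Matrix (Fin m) (Fin N) ℝ) {lam : ℝ} (hlam : 0 < lam) :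
    (Xᵀ * X + lam • (1 : Matrix (Fin N) (Fin N) ℝ)).PosDef := by
  have h := posSemidef_conjTranspose_mul_self X
  rw [conjTranspose_eq_transpose_of_trivial] at h
  exact PosDef.posSemidef_add h (PosDef.one.smul hlam)

/-! ### OPTQ with stochastic rounding -/

/-- The factor `L` with `(Xᵀ X + λ I)⁻¹ = L Lᵀ` that the algorithm uses. -/
def optqFactor {m N : ℕ} (X : Matrix (Fin m) (Fin N) ℝ) (lam : ℝ) : Matrix (Fin N) (Fin N) ℝ :=
  choleskyFactor (Xᵀ * X + lam • (1 : Matrix (Fin N) (Fin N) ℝ))⁻¹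

lemma optqFactor_spec {m N : ℕ} (X : Matrix (Fin m) (Fin N) ℝ) {lam : ℝ} (hlam : 0 < lam) :
    IsCholesky (Xᵀ * X + lam • (1 : Matrix (Fin N) (Fin N) ℝ))⁻¹ (optqFactor X lam) :=
  choleskyFactor_spec (hessian_posDef X hlam).inv

/-- One iteration (at coordinate `t`, from the state `v`): draw the quantized value `q` of `v t`
with fresh randomness, store it at coordinate `t`, and replace every later coordinate `v i` by
`v i + (q - v t) * L i t / L t t`; the coordinates before `t` are already quantized and stay. -/
def optqStep {N : ℕ} (L : Matrix (Fin N) (Fin N) ℝ) (δ : ℝ) (t : Fin N) (v : Fin N → ℝ) :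
    PMF (Fin N → ℝ) :=
  (stochRound δ (v t)).map fun q i =>
    if i < t then v i else if i = t then q else v i + (q - v t) * (L i t / L t t)

/-- The law of the state `(q₁, …, q_t, w⁽ᵗ⁾_{t+1}, …, w⁽ᵗ⁾_N)` after `t` iterations started at `w`
(the state does not change any more after `N` iterations). -/
def optqState {N : ℕ} (L : Matrix (Fin N) (Fin N) ℝ) (δ : ℝ) (w : Fin N → ℝ) :
    ℕ → PMF (Fin N → ℝ)
  | 0 => PMF.pure w
  | t + 1 => (optqState L δ w t).bind fun v =>
      if h : t < N then optqStep L δ ⟨t, h⟩ v else PMF.pure v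

/-- The law of the output `q` of OPTQ with stochastic rounding on one column `w`. -/
def optqColumn {m N : ℕ} (X : Matrix (Fin m) (Fin N) ℝ) (lam δ : ℝ) (w : Fin N → ℝ) :
    PMF (Fin N → ℝ) :=
  optqState (optqFactor X lam) δ w N

/-- The law of the output of OPTQ with stochastic rounding on the weight matrix `W`: the columns of
`W` are processed in parallel, with independent draws. A sample `c` is the family of the columns of
the quantized matrix; see `ofColumns`. -/
def optqLayer {m N N' : ℕ} (X : Matrix (Fin m) (Fin N) ℝ) (lam δ : ℝ)
    (W : Matrix (Fin N) (Fin N') ℝ) : Measure (Fin N' → Fin N → ℝ) :=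
  Measure.pi fun k => (optqColumn X lam δ fun i => W i k).toMeasure

instance {m N N' : ℕ} (X : Matrix (Fin m) (Fin N) ℝ) (lam δ : ℝ)
    (W : Matrix (Fin N) (Fin N') ℝ) : IsProbabilityMeasure (optqLayer X lam δ W) := by
  unfold optqLayer; infer_instance

/-- The matrix whose `k`-th column is `c k`. -/
def ofColumns {N N' : ℕ} (c : Fin N' → Fin N → ℝ) : Matrix (Fin N) (Fin N') ℝ :=
  Matrix.of fun i k => c k i

/-! ### The constant in the bound -/

/-- The smallest singular value of an `m × n` matrix, i.e. the last of its `min m n` singular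
values (which may be zero). -/
def sigmaMin {m n : Type*} [Fintype m] [Fintype n] [DecidableEq n]
    (A : Matrix m n ℝ) : ℝ :=
  A.toEuclideanLin.singularValues (min (Fintype.card m) (Fintype.card n) - 1)

/-- The submatrix of `X` formed by the columns after the `j`-th one. -/
def colsAfter {m N : ℕ} (X : Matrix (Fin m) (Fin N) ℝ) (j : Fin N) :
    Matrix (Fin m) {k : Fin N // j < k} ℝ :=
  X.submatrix id Subtype.val

/-- The Euclidean norm of the `j`-th column of `X`. -/
def colNorm {m N : ℕ} (X : Matrix (Fin m) (Fin N) ℝ) (j : Fin N) : ℝ :=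
  ‖WithLp.toLp 2 fun i => X i j‖

/-- `C_∞(X, λ)`. In the one-based numbering of the columns, `j : Fin N` is the column with number
`j + 1`, so that the first case below is the range of numbers at most `N - m`. The supremum is a
maximum over the finite set of columns. -/
def CInf {m N : ℕ} (X : Matrix (Fin m) (Fin N) ℝ) (lam : ℝ) : ℝ :=
  √((⨆ j : Fin N,
      if (j : ℕ) + 1 + m ≤ N then lam * colNorm X j ^ 2 / (sigmaMin (colsAfter X j) ^ 2 + lam)
      else colNorm X j ^ 2) + lam)

end

end OPTQ

/-!
Why the bounds hold. Write `H = Xᵀ X + λ I = (L Lᵀ)⁻¹`. One OPTQ iteration adds the rounding error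
`η t` times the column `L · t / L t t` to the state (`optqStep_eq`), so the output satisfies
`q - w = ∑ t, η t • L · t / L t t`. Given the past, `η t` has mean zero and lies in an interval of
length `δ`; Hoeffding's lemma (`tsum_stochRound_exp_le`), iterated over the steps
(`tsum_optqState_exp_le`), shows that every linear functional `g` of `q - w` is sub-Gaussian with
variance proxy `δ² / 4 * ∑ t, ((g L) t / L t t)²`.

Two facts about `L` control this sum. If `g` is a row of `X` or of `√λ I`, then `‖g L‖ ≤ 1`, because
`(g · y)² ≤ yᵀ H y` (`vecMul_dotProduct_self_le_one`). And `1 / L t t ^ 2 ≤ C_∞²`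
(`sq_inv_diag_le_CInf`), because `1 / L t t ^ 2` is at most `aᵀ H a` for every vector `a` that
vanishes before `t` and has `a t = 1`: with `b = -(a k)_{k > t}` this is the value
`‖X_t - X_{>t} b‖² + λ ‖b‖² + λ` of a ridge regression of `X_t` on the later columns. The choice
`b = 0` gives `‖X_t‖² + λ`; when there are at least `m` later columns, shrinking a minimal-norm
solution of `X_{>t} b = X_t` gives the bound with the smallest singular value (`exists_ridge_le`).

A union bound over the `m + N` rows and both signs yields the failure probability
`2 (m + N) exp (-4 π r)` at the deviation `δ √(2 π r) C_∞`. It is at most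
`√2 (m + N) exp (-r)` whenever the latter is below one (`le_measureReal_of_compl_le`); the claims
are the cases `r = p log N` for one column and `r = p log N + p' log N'` for a union over the
`N'` columns.
-/

namespace OPTQ

/-! ### Singular values and ridge regression -/

section SingularValues

variable {E F : Type*} [NormedAddCommGroup E] [InnerProductSpace ℝ E] [FiniteDimensional ℝ E]
  [NormedAddCommGroup F] [InnerProductSpace ℝ F] [FiniteDimensional ℝ F]

/-- Away from its kernel, a linear map whose rank is at most `n + 1` stretches vectors at least by
its `(n + 1)`-st singular value: the eigenvectors of `T† T` for smaller eigenvalues lie in the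
kernel. -/
lemma singularValues_mul_norm_le (T : E →ₗ[ℝ] F) {n : ℕ}
    (hn : Module.finrank ℝ T.range ≤ n + 1) {v : E} (hv : v ∈ T.kerᗮ) :
    T.singularValues n * ‖v‖ ≤ ‖T v‖ := by
  have hT := T.isSymmetric_adjoint_comp_self
  set b := hT.eigenvectorBasis rfl with hb
  have hsq (i : Fin (Module.finrank ℝ E)) : T.singularValues i ^ 2 = hT.eigenvalues rfl i :=
    T.sq_singularValues_fin rfl i
  have hbi (i : Fin (Module.finrank ℝ E)) : (LinearMap.adjoint T ∘ₗ T) (b i)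
      = (T.singularValues i ^ 2) • b i := by
    rw [hsq]; exact hT.apply_eigenvectorBasis rfl i
  have hcoef (i : Fin (Module.finrank ℝ E)) : inner ℝ (b i) ((LinearMap.adjoint T ∘ₗ T) v)
      = T.singularValues i ^ 2 * inner ℝ (b i) v := by
    rw [← hT, hbi, inner_smul_left]; rfl
  have hTv : ‖T v‖ ^ 2
      = ∑ i : Fin (Module.finrank ℝ E), T.singularValues i ^ 2 * inner ℝ (b i) v ^ 2 := by
    rw [← real_inner_self_eq_norm_sq, ← LinearMap.adjoint_inner_right, ← b.sum_inner_mul_inner]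
    refine Finset.sum_congr rfl fun i _ => ?_
    have := hcoef i
    rw [LinearMap.comp_apply] at this
    rw [this, real_inner_comm v]; ring
  have hvv : ‖v‖ ^ 2 = ∑ i, inner ℝ (b i) v ^ 2 := by
    rw [← b.sum_sq_norm_inner_right]; simp
  refine le_of_sq_le_sq ?_ (norm_nonneg _)
  rw [mul_pow, hTv, hvv, Finset.mul_sum]
  refine Finset.sum_le_sum fun i _ => ?_
  by_cases hi : (i : ℕ) ≤ n
  · have h0 := T.singularValues_nonneg n
    have h1 := T.singularValues_antitone hi
    gcongr
  · have hz : T.singularValues i = 0 := by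
      rw [LinearMap.singularValues_eq_zero_iff_le_finrank_range]; omega
    have hker : b i ∈ T.ker := by
      rw [LinearMap.mem_ker, ← inner_self_eq_zero (𝕜 := ℝ), ← LinearMap.adjoint_inner_right]
      have := hbi i
      rw [LinearMap.comp_apply] at this
      simp [this, hz]
    have : inner ℝ (b i) v = 0 := (Submodule.mem_orthogonal _ _).1 hv _ hker
    simp [this]

/-- If the singular value with index `dim F - 1` is positive, then `T` is onto, and every `x` has a
preimage of norm at most `‖x‖` divided by that singular value. -/
lemma exists_preimage_norm_le (T : E →ₗ[ℝ] F) {n : ℕ} (hn : Module.finrank ℝ F = n + 1)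
    (hs : 0 < T.singularValues n) (x : F) :
    ∃ v, T v = x ∧ T.singularValues n * ‖v‖ ≤ ‖x‖ := by
  have hr := T.singularValues_pos_iff_lt_finrank_range.1 hs
  have hle : Module.finrank ℝ T.range ≤ n + 1 := hn ▸ Submodule.finrank_le _
  have htop : T.range = ⊤ := Submodule.eq_top_of_finrank_eq (by omega)
  obtain ⟨u, hu⟩ := LinearMap.range_eq_top.1 htop x
  obtain ⟨y, hy, z, hz, rfl⟩ := T.ker.exists_add_mem_mem_orthogonal u
  have hz' : T z = x := by
    rw [← hu, map_add, LinearMap.mem_ker.1 hy, zero_add]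
  exact ⟨z, hz', hz' ▸ singularValues_mul_norm_le T hle hz⟩

/-- Upper bound for the optimal value of the ridge regression of `x` on the range of `T`, in terms
of the singular value of `T` with index `dim F - 1`. -/
lemma exists_ridge_le (T : E →ₗ[ℝ] F) {n : ℕ} (hn : Module.finrank ℝ F = n + 1) (x : F)
    {lam : ℝ} (hlam : 0 < lam) :
    ∃ b, ‖x - T b‖ ^ 2 + lam * ‖b‖ ^ 2 ≤ lam * ‖x‖ ^ 2 / (T.singularValues n ^ 2 + lam) := by
  rcases (T.singularValues_nonneg n).eq_or_lt with h0 | hs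
  · refine ⟨0, ?_⟩
    rw [← h0]
    simp [hlam.ne']
  obtain ⟨v, hv, hvx⟩ := exists_preimage_norm_le T hn hs x
  set s := T.singularValues n
  -- Shrinking the preimage by `s² / (s² + λ)` balances the residual against the penalty.
  set c := s ^ 2 / (s ^ 2 + lam) with hc
  have hpos : 0 < s ^ 2 + lam := by positivity
  refine ⟨c • v, ?_⟩
  have h1 : x - T (c • v) = (1 - c) • x := by rw [map_smul, hv, sub_smul, one_smul]
  have h2 : s ^ 2 * ‖v‖ ^ 2 ≤ ‖x‖ ^ 2 := by
    rw [← mul_pow]; gcongr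
  have h3 : 1 - c = lam / (s ^ 2 + lam) := by rw [hc]; field_simp; ring
  rw [h1, h3, norm_smul, norm_smul, mul_pow, mul_pow, Real.norm_eq_abs, Real.norm_eq_abs, sq_abs,
    sq_abs, hc]
  have h4 : lam * ‖x‖ ^ 2 / (s ^ 2 + lam) = (lam / (s ^ 2 + lam)) ^ 2 * ‖x‖ ^ 2
      + lam * s ^ 2 / (s ^ 2 + lam) ^ 2 * ‖x‖ ^ 2 := by
    field_simp; ring
  have h5 : lam * ((s ^ 2 / (s ^ 2 + lam)) ^ 2 * ‖v‖ ^ 2)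
      = lam * s ^ 2 / (s ^ 2 + lam) ^ 2 * (s ^ 2 * ‖v‖ ^ 2) := by
    field_simp
  rw [h4, h5]
  gcongr

end SingularValues

/-! ### Exponential moments of the quantization error -/

/-- Hoeffding's lemma for the error of stochastic rounding, which has mean zero and takes its two
values in an interval of length `δ`. -/
lemma tsum_stochRound_exp_le {δ : ℝ} (hδ : 0 < δ) (z θ : ℝ) :
    ∑' q, stochRound δ z q * ENNReal.ofReal (Real.exp (θ * (q - z)))
      ≤ ENNReal.ofReal (Real.exp (θ ^ 2 * δ ^ 2 / 8)) := by
  set Y : Bool → ℝ := fun b => cond b (⌊z / δ⌋ * δ) ((⌊z / δ⌋ + 1) * δ) - z with hY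
  have hp0 := roundDownProb_nonneg δ z
  have hp1 := roundDownProb_le_one δ z
  have hz : z / δ * δ = z := div_mul_cancel₀ z hδ.ne'
  have htr : (roundCoin δ z true).toReal = roundDownProb δ z := by
    simp [roundCoin, hp0]
  have hfa : (roundCoin δ z false).toReal = 1 - roundDownProb δ z := by
    simp [roundCoin, hp1]
  have hmean : ∫ b, Y b ∂(roundCoin δ z).toMeasure = 0 := by
    rw [PMF.integral_eq_sum, Fintype.sum_bool, htr, hfa]
    simp only [hY, cond_true, cond_false, smul_eq_mul, roundDownProb]
    linear_combination (1 : ℝ) * hz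
  have hsub := ProbabilityTheory.hasSubgaussianMGF_of_mem_Icc_of_integral_eq_zero
    (X := Y) (μ := (roundCoin δ z).toMeasure) (a := ⌊z / δ⌋ * δ - z)
    (b := (⌊z / δ⌋ + 1) * δ - z) (measurable_of_finite Y).aemeasurable
    (Filter.Eventually.of_forall fun b => by
      cases b <;> simp only [hY, cond_true, cond_false, Set.mem_Icc] <;> constructor <;> nlinarith)
    hmean
  have hmgf := hsub.mgf_le θ
  have hlen : ((⌊z / δ⌋ : ℝ) + 1) * δ - z - (⌊z / δ⌋ * δ - z) = δ := by ring
  rw [hlen, ProbabilityTheory.mgf, PMF.integral_eq_sum, Fintype.sum_bool] at hmgf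
  have hmap : ∑' q, stochRound δ z q * ENNReal.ofReal (Real.exp (θ * (q - z)))
      = ∑ b, roundCoin δ z b * ENNReal.ofReal (Real.exp (θ * Y b)) := by
    simp only [stochRound, PMF.map, PMF.bind_apply, ← ENNReal.tsum_mul_right]
    rw [ENNReal.tsum_comm, tsum_fintype]
    refine Finset.sum_congr rfl fun b _ => ?_
    rw [tsum_eq_single (cond b (⌊z / δ⌋ * δ) ((⌊z / δ⌋ + 1) * δ))]
    · simp [hY]
    · intro q hq
      simp [hq]
  rw [hmap, Fintype.sum_bool, ← ENNReal.ofReal_toReal ((roundCoin δ z).apply_ne_top true),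
    ← ENNReal.ofReal_toReal ((roundCoin δ z).apply_ne_top false),
    ← ENNReal.ofReal_mul ENNReal.toReal_nonneg, ← ENNReal.ofReal_mul ENNReal.toReal_nonneg,
    ← ENNReal.ofReal_add (by positivity) (by positivity)]
  refine ENNReal.ofReal_le_ofReal (hmgf.trans_eq ?_)
  congr 1
  simp [abs_of_pos hδ]
  ring

lemma tsum_bind_mul {α β : Type*} (μ : PMF α) (κ : α → PMF β) (f : β → ENNReal) :
    ∑' y, μ.bind κ y * f y = ∑' x, μ x * ∑' y, κ x y * f y := by
  simp only [PMF.bind_apply, ← ENNReal.tsum_mul_right, ← ENNReal.tsum_mul_left, mul_assoc]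
  exact ENNReal.tsum_comm

lemma tsum_map_mul {α β : Type*} (μ : PMF α) (φ : α → β) (f : β → ENNReal) :
    ∑' y, μ.map φ y * f y = ∑' x, μ x * f (φ x) := by
  rw [PMF.map, tsum_bind_mul]
  refine tsum_congr fun x => ?_
  rw [tsum_eq_single (φ x)]
  · simp
  · intro y hy
    simp [hy]

/-- One iteration adds to the state the rounding error times a rescaled column of the lower
triangular `L`. -/
lemma optqStep_eq {N : ℕ} {L : Matrix (Fin N) (Fin N) ℝ} (hlow : ∀ i j, i < j → L i j = 0)
    (hdiag : ∀ i, 0 < L i i) (δ : ℝ) (t : Fin N) (v : Fin N → ℝ) :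
    optqStep L δ t v = (stochRound δ (v t)).map fun q i => v i + (q - v t) * (L i t / L t t) := by
  unfold optqStep
  congr 1
  funext q i
  split_ifs with h1 h2
  · simp [hlow i t h1]
  · subst h2
    rw [div_self (hdiag i).ne']; ring
  · rfl

/-- The exponential moment of a linear functional `g` of the error after `n` iterations: each
iteration contributes a factor by Hoeffding's lemma, conditionally on the past. -/
lemma tsum_optqState_exp_le {N : ℕ} {L : Matrix (Fin N) (Fin N) ℝ}
    (hlow : ∀ i j, i < j → L i j = 0) (hdiag : ∀ i, 0 < L i i) {δ : ℝ} (hδ : 0 < δ)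
    (w g : Fin N → ℝ) (n : ℕ) :
    ∑' v, optqState L δ w n v * ENNReal.ofReal (Real.exp (g ⬝ᵥ (v - w)))
      ≤ ENNReal.ofReal (Real.exp
          ((∑ t : Fin N with t.val < n, ((g ᵥ* L) t / L t t) ^ 2) * δ ^ 2 / 8)) := by
  induction n with
  | zero =>
    rw [optqState, tsum_eq_single w]
    · simp
    · intro v hv; simp [hv]
  | succ n ih =>
    rw [optqState, tsum_bind_mul]
    split_ifs with h
    · set θ := (g ᵥ* L) ⟨n, h⟩ / L ⟨n, h⟩ ⟨n, h⟩ with hθ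
      have hstep (v : Fin N → ℝ) :
          ∑' y, optqStep L δ ⟨n, h⟩ v y * ENNReal.ofReal (Real.exp (g ⬝ᵥ (y - w)))
            ≤ ENNReal.ofReal (Real.exp (g ⬝ᵥ (v - w)))
                * ENNReal.ofReal (Real.exp (θ ^ 2 * δ ^ 2 / 8)) := by
        rw [optqStep_eq hlow hdiag, tsum_map_mul]
        refine le_trans (le_of_eq ?_)
          (mul_le_mul_right (tsum_stochRound_exp_le hδ (v ⟨n, h⟩) θ) _)
        rw [← ENNReal.tsum_mul_left]
        refine tsum_congr fun q => ?_
        have : g ⬝ᵥ ((fun i => v i + (q - v ⟨n, h⟩) * (L i ⟨n, h⟩ / L ⟨n, h⟩ ⟨n, h⟩)) - w)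
            = g ⬝ᵥ (v - w) + θ * (q - v ⟨n, h⟩) := by
          simp only [hθ, vecMul, dotProduct, Pi.sub_apply, Finset.sum_div, Finset.sum_mul,
            ← Finset.sum_add_distrib]
          exact Finset.sum_congr rfl fun i _ => by ring
        rw [this, Real.exp_add, ENNReal.ofReal_mul (Real.exp_pos _).le]
        ring
      have hset : (Finset.univ.filter fun t : Fin N => t.val < n + 1)
          = insert ⟨n, h⟩ (Finset.univ.filter fun t : Fin N => t.val < n) := by
        ext t; simp [Fin.ext_iff]; omega
      rw [hset, Finset.sum_insert (by simp), ← hθ, add_mul, add_div, add_comm, Real.exp_add,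
        ENNReal.ofReal_mul (Real.exp_pos _).le]
      calc _ ≤ ∑' v, optqState L δ w n v * (ENNReal.ofReal (Real.exp (g ⬝ᵥ (v - w)))
                * ENNReal.ofReal (Real.exp (θ ^ 2 * δ ^ 2 / 8))) :=
            ENNReal.tsum_le_tsum fun v => mul_le_mul_right (hstep v) _
        _ ≤ _ := by
            simp only [← mul_assoc]
            rw [ENNReal.tsum_mul_right]
            exact mul_le_mul_left ih _
    · have hset : (Finset.univ.filter fun t : Fin N => t.val < n + 1)
          = Finset.univ.filter fun t : Fin N => t.val < n := by
        ext t; have := t.isLt; simp; omega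
      rw [hset]
      refine le_trans (le_of_eq (tsum_congr fun v => ?_)) ih
      rw [tsum_eq_single v]
      · simp
      · intro y hy; simp [hy]

/-- Chernoff's bound for a probability mass function. -/
lemma toMeasure_le_of_tsum_exp_le {α : Type*} [MeasurableSpace α] (μ : PMF α) {f : α → ℝ}
    (hf : Measurable f) {s b : ℝ}
    (h : ∑' x, μ x * ENNReal.ofReal (Real.exp (f x)) ≤ ENNReal.ofReal (Real.exp b)) :
    μ.toMeasure {x | s < f x} ≤ ENNReal.ofReal (Real.exp (b - s)) := by
  rw [PMF.toMeasure_apply _ (measurableSet_lt measurable_const hf), sub_eq_add_neg, Real.exp_add,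
    ENNReal.ofReal_mul (Real.exp_pos _).le]
  refine le_trans ?_ (mul_le_mul_left h _)
  rw [← ENNReal.tsum_mul_right]
  refine ENNReal.tsum_le_tsum fun x => ?_
  by_cases hx : s < f x
  · rw [Set.indicator_of_mem (by exact hx), mul_assoc, ← ENNReal.ofReal_mul (Real.exp_pos _).le,
      ← Real.exp_add]
    refine le_mul_of_one_le_right' ?_
    rw [ENNReal.one_le_ofReal, Real.one_le_exp_iff]
    linarith
  · rw [Set.indicator_of_notMem (by exact hx)]
    exact zero_le

/-- A linear functional `g` of the output error has the tail of a sub-Gaussian variable, if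
`g L` is a vector of norm at most one and the reciprocals of the diagonal of `L` are at most `C`. -/
lemma optqState_tail {N : ℕ} {L : Matrix (Fin N) (Fin N) ℝ}
    (hlow : ∀ i j, i < j → L i j = 0) (hdiag : ∀ i, 0 < L i i) {δ : ℝ} (hδ : 0 < δ)
    (w g : Fin N → ℝ) {C : ℝ} (hC : 0 < C) (hLC : ∀ t, (1 / L t t) ^ 2 ≤ C ^ 2)
    (hg : (g ᵥ* L) ⬝ᵥ (g ᵥ* L) ≤ 1) {r : ℝ} (hr : 0 ≤ r) :
    (optqState L δ w N).toMeasure {v | δ * √(2 * Real.pi * r) * C < g ⬝ᵥ (v - w)}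
      ≤ ENNReal.ofReal (Real.exp (-(4 * Real.pi * r))) := by
  set s := δ * √(2 * Real.pi * r) * C with hs
  -- The optimal Chernoff parameter for the variance proxy `(δ C / 2) ^ 2`.
  set θ := 4 * s / (δ * C) ^ 2 with hθ
  have hpi := Real.pi_pos
  have hs2 : s ^ 2 = (δ * C) ^ 2 * (2 * Real.pi * r) := by
    rw [hs, mul_pow, mul_pow, Real.sq_sqrt (by positivity)]; ring
  have hs0 : 0 ≤ s := by positivity
  have hC2 : 0 < (δ * C) ^ 2 := by positivity
  have hmom := tsum_optqState_exp_le hlow hdiag hδ w (θ • g) N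
  have hsum : ∑ t : Fin N with t.val < N, (((θ • g) ᵥ* L) t / L t t) ^ 2 ≤ θ ^ 2 * C ^ 2 := by
    calc _ = θ ^ 2 * ∑ t : Fin N, ((g ᵥ* L) t) ^ 2 * (1 / L t t) ^ 2 := by
          rw [Finset.filter_true_of_mem fun t _ => t.isLt, Finset.mul_sum]
          refine Finset.sum_congr rfl fun t _ => ?_
          rw [smul_vecMul, Pi.smul_apply, smul_eq_mul]; ring
      _ ≤ θ ^ 2 * ∑ t : Fin N, ((g ᵥ* L) t) ^ 2 * C ^ 2 := by
          exact mul_le_mul_of_nonneg_left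
            (Finset.sum_le_sum fun t _ => mul_le_mul_of_nonneg_left (hLC t) (sq_nonneg _))
            (sq_nonneg _)
      _ ≤ θ ^ 2 * C ^ 2 := by
          rw [← Finset.sum_mul]
          have : ∑ t : Fin N, ((g ᵥ* L) t) ^ 2 ≤ 1 := by
            simpa only [dotProduct, ← sq] using hg
          have h0 := mul_le_mul_of_nonneg_right this (sq_nonneg C)
          rw [one_mul] at h0
          gcongr
  have hmom' : ∑' v, optqState L δ w N v * ENNReal.ofReal (Real.exp (θ * (g ⬝ᵥ (v - w))))
      ≤ ENNReal.ofReal (Real.exp (4 * Real.pi * r)) := by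
    simp only [smul_dotProduct, smul_eq_mul] at hmom
    refine hmom.trans (ENNReal.ofReal_le_ofReal (Real.exp_le_exp.2 ?_))
    calc _ ≤ θ ^ 2 * C ^ 2 * δ ^ 2 / 8 := by gcongr
      _ = 2 * s ^ 2 / (δ * C) ^ 2 := by rw [hθ]; field_simp; ring
      _ = 4 * Real.pi * r := by rw [hs2]; field_simp; ring
  have hmeas : Measurable fun v : Fin N → ℝ => θ * (g ⬝ᵥ (v - w)) := by
    unfold dotProduct; fun_prop
  have hch := toMeasure_le_of_tsum_exp_le (optqState L δ w N) hmeas (s := 8 * Real.pi * r) hmom'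
  -- For `r = 0` the bound is one, and `θ = 0` is no valid Chernoff parameter.
  rcases hr.eq_or_lt with rfl | hr
  · simpa using prob_le_one
  have hs0 : 0 < s := by positivity
  have hθ0 : 0 < θ := by positivity
  have hθs : θ * s = 8 * Real.pi * r := by
    rw [hθ, div_mul_eq_mul_div, mul_assoc, ← sq, hs2]; field_simp; ring
  convert hch using 3
  · ext v
    rw [← hθs]
    exact (mul_lt_mul_iff_right₀ hθ0).symm
  · ring

/-! ### The Cholesky factor of the inverse Hessian -/

section Cholesky

variable {N : ℕ} {H L : Matrix (Fin N) (Fin N) ℝ}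

/-- The reciprocal squared diagonal entry `1 / L t t ^ 2` is a lower bound (in fact the minimum)
of the quadratic form `H` over the vectors that are `1` at `t` and vanish before `t`. -/
lemma sq_inv_diag_le (hH : H.PosDef) (hL : IsCholesky H⁻¹ L) (t : Fin N) {a : Fin N → ℝ}
    (hat : a t = 1) (ha : ∀ k < t, a k = 0) : (1 / L t t) ^ 2 ≤ a ⬝ᵥ (H *ᵥ a) := by
  have hu : IsUnit H.det := (Matrix.isUnit_iff_isUnit_det _).1 hH.isUnit
  set c := Lᵀ *ᵥ (H *ᵥ a) with hc
  have hLc : L *ᵥ c = a := by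
    rw [hc, mulVec_mulVec, hL.mul_transpose, mulVec_mulVec, nonsing_inv_mul _ hu, one_mulVec]
  have hcc : c ⬝ᵥ c = a ⬝ᵥ (H *ᵥ a) := by
    nth_rw 1 [hc]
    rw [mulVec_transpose, ← dotProduct_mulVec, hLc, dotProduct_comm]
  have hrow (k : Fin N) (h0 : ∀ j < k, c j = 0) : L k k * c k = a k := by
    rw [← hLc, mulVec, dotProduct, Finset.sum_eq_single k]
    · intro j _ hj
      rcases lt_or_gt_of_ne hj with h | h
      · rw [h0 j h, mul_zero]
      · rw [hL.lower k j h, zero_mul]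
    · simp
  have hzero : ∀ k < t, c k = 0 := by
    intro k
    induction k using WellFoundedLT.induction with
    | ind k ih =>
      intro hk
      have := hrow k fun j hj => ih j hj (hj.trans hk)
      rw [ha k hk] at this
      exact (mul_eq_zero.1 this).resolve_left (hL.diag_pos k).ne'
  have hct : c t = 1 / L t t := by
    rw [eq_div_iff (hL.diag_pos t).ne', mul_comm, hrow t hzero, hat]
  rw [← hcc, ← hct, sq]
  exact Finset.single_le_sum (f := fun k => c k * c k) (fun k _ => mul_self_nonneg _)
    (Finset.mem_univ t)

/-- `‖Lᵀ g‖² = gᵀ H⁻¹ g` is at most one if the square of the functional `g` is dominated by the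
quadratic form `H`. -/
lemma vecMul_dotProduct_self_le_one (hH : H.PosDef) (hL : IsCholesky H⁻¹ L) {g : Fin N → ℝ}
    (hg : ∀ y, (g ⬝ᵥ y) ^ 2 ≤ y ⬝ᵥ (H *ᵥ y)) : (g ᵥ* L) ⬝ᵥ (g ᵥ* L) ≤ 1 := by
  have hu : IsUnit H.det := (Matrix.isUnit_iff_isUnit_det _).1 hH.isUnit
  have h1 : (g ᵥ* L) ⬝ᵥ (g ᵥ* L) = g ⬝ᵥ (H⁻¹ *ᵥ g) := by
    rw [← hL.mul_transpose, ← mulVec_mulVec, mulVec_transpose, dotProduct_mulVec g]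
  have h2 := hg (H⁻¹ *ᵥ g)
  rw [mulVec_mulVec, mul_nonsing_inv _ hu, one_mulVec, dotProduct_comm (H⁻¹ *ᵥ g), ← h1] at h2
  nlinarith

end Cholesky

lemma dotProduct_hessian_mulVec {m N : ℕ} (X : Matrix (Fin m) (Fin N) ℝ) (lam : ℝ)
    (a : Fin N → ℝ) :
    a ⬝ᵥ ((Xᵀ * X + lam • (1 : Matrix (Fin N) (Fin N) ℝ)) *ᵥ a)
      = (X *ᵥ a) ⬝ᵥ (X *ᵥ a) + lam * (a ⬝ᵥ a) := by
  rw [add_mulVec, dotProduct_add, smul_mulVec, one_mulVec, dotProduct_smul, smul_eq_mul,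
    ← mulVec_mulVec, dotProduct_mulVec, vecMul_transpose]

/-! ### The constant `C_∞` -/

lemma colNorm_sq {m N : ℕ} (X : Matrix (Fin m) (Fin N) ℝ) (j : Fin N) :
    colNorm X j ^ 2 = X.col j ⬝ᵥ X.col j := by
  rw [colNorm, EuclideanSpace.norm_sq_eq]
  simp [dotProduct, sq]

lemma sum_eq_add_sum_gt {N : ℕ} (t : Fin N) {f : Fin N → ℝ} (hf : ∀ k < t, f k = 0) :
    ∑ k, f k = f t + ∑ k : {k : Fin N // t < k}, f k := by
  rw [← Finset.sum_filter_add_sum_filter_not Finset.univ (fun k => t < k), add_comm,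
    Finset.sum_subtype (Finset.univ.filter fun k => t < k) (p := fun k => t < k) (by simp)]
  congr 1
  refine Finset.sum_eq_single t ?_ (by simp)
  intro k hk hkt
  exact hf k (lt_of_le_of_ne (not_lt.1 (Finset.mem_filter.1 hk).2) hkt)

/-- The column `t` of `X` can be approximated by the later columns with penalized residual bounded
by the smallest singular value, provided there are at least `m` later columns. -/
lemma exists_ridge_colsAfter_le {m N : ℕ} (X : Matrix (Fin m) (Fin N) ℝ) {lam : ℝ}
    (hlam : 0 < lam) {t : Fin N} (ht : (t : ℕ) + 1 + m ≤ N) :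
    ∃ b : EuclideanSpace ℝ {k : Fin N // t < k},
      ‖WithLp.toLp 2 (fun i => X i t) - (colsAfter X t).toEuclideanLin b‖ ^ 2 + lam * ‖b‖ ^ 2
        ≤ lam * colNorm X t ^ 2 / (sigmaMin (colsAfter X t) ^ 2 + lam) := by
  rcases m with _ | n
  -- Without rows there are no singular values; both sides vanish at `b = 0`.
  · exact ⟨0, by simp [colNorm, EuclideanSpace.norm_eq]⟩
  · have hcard : Fintype.card {k : Fin N // t < k} = N - 1 - t := by
      rw [Fintype.card_subtype, Finset.filter_lt_eq_Ioi, Fin.card_Ioi]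
    have hmin : min (Fintype.card (Fin (n + 1))) (Fintype.card {k : Fin N // t < k}) - 1 = n := by
      rw [hcard, Fintype.card_fin]; omega
    unfold sigmaMin
    rw [hmin]
    exact exists_ridge_le _ (by simp) _ hlam

lemma sq_inv_diag_le_colNorm {m N : ℕ} (X : Matrix (Fin m) (Fin N) ℝ) {lam : ℝ} (hlam : 0 < lam)
    (t : Fin N) : (1 / optqFactor X lam t t) ^ 2 ≤ colNorm X t ^ 2 + lam := by
  refine (sq_inv_diag_le (hessian_posDef X hlam) (optqFactor_spec X hlam) t
    (a := Pi.single t 1) (by simp) fun k hk => by simp [hk.ne]).trans_eq ?_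
  rw [dotProduct_hessian_mulVec, mulVec_single_one, colNorm_sq]
  simp

lemma sq_inv_diag_le_sigmaMin {m N : ℕ} (X : Matrix (Fin m) (Fin N) ℝ) {lam : ℝ} (hlam : 0 < lam)
    {t : Fin N} (ht : (t : ℕ) + 1 + m ≤ N) :
    (1 / optqFactor X lam t t) ^ 2
      ≤ lam * colNorm X t ^ 2 / (sigmaMin (colsAfter X t) ^ 2 + lam) + lam := by
  obtain ⟨b, hb⟩ := exists_ridge_colsAfter_le X hlam ht
  set a : Fin N → ℝ := fun k => if h : t < k then - b ⟨k, h⟩ else if k = t then 1 else 0 with ha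
  have hat : a t = 1 := by simp [ha]
  have ha0 : ∀ k < t, a k = 0 := fun k hk => by simp [ha, hk.le, hk.ne]
  have hab (k : {k : Fin N // t < k}) : a k = - b k := by simp [ha, k.2]
  refine (sq_inv_diag_le (hessian_posDef X hlam) (optqFactor_spec X hlam) t hat ha0).trans ?_
  rw [dotProduct_hessian_mulVec]
  have h1 : a ⬝ᵥ a = 1 + ‖b‖ ^ 2 := by
    rw [dotProduct, sum_eq_add_sum_gt t fun k hk => by simp [ha0 k hk], hat,
      EuclideanSpace.norm_sq_eq]
    simp [hab, sq]
  have h2 : X *ᵥ a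
      = (WithLp.toLp 2 (fun i => X i t) - (colsAfter X t).toEuclideanLin b).ofLp := by
    ext i
    rw [mulVec, dotProduct, sum_eq_add_sum_gt t fun k hk => by simp [ha0 k hk], hat]
    simp [hab, colsAfter, mulVec, dotProduct, sub_eq_add_neg, Matrix.toLpLin_apply]
  have h3 : (X *ᵥ a) ⬝ᵥ (X *ᵥ a)
      = ‖WithLp.toLp 2 (fun i => X i t) - (colsAfter X t).toEuclideanLin b‖ ^ 2 := by
    rw [h2, EuclideanSpace.norm_sq_eq]
    simp [dotProduct, sq]
  rw [h1, h3]
  linarith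

lemma CInf_pos {m N : ℕ} (X : Matrix (Fin m) (Fin N) ℝ) {lam : ℝ} (hlam : 0 < lam) :
    0 < CInf X lam := by
  refine Real.sqrt_pos.2 (add_pos_of_nonneg_of_pos (Real.iSup_nonneg fun j => ?_) hlam)
  split_ifs <;> positivity

lemma sq_inv_diag_le_CInf {m N : ℕ} (X : Matrix (Fin m) (Fin N) ℝ) {lam : ℝ} (hlam : 0 < lam)
    (t : Fin N) : (1 / optqFactor X lam t t) ^ 2 ≤ CInf X lam ^ 2 := by
  have hsq := Real.sqrt_pos.1 (CInf_pos X hlam)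
  rw [CInf, Real.sq_sqrt hsq.le]
  refine le_trans ?_ (add_le_add_left (le_ciSup (Set.finite_range _).bddAbove t) lam)
  split_ifs with ht
  · exact sq_inv_diag_le_sigmaMin X hlam ht
  · exact sq_inv_diag_le_colNorm X hlam t

/-! ### Tail bounds for one column -/

/-- The rows of the matrix `X` extended by the rows of `√λ I`. -/
noncomputable def extendedRow {m N : ℕ} (X : Matrix (Fin m) (Fin N) ℝ) (lam : ℝ) :
    Fin m ⊕ Fin N → Fin N → ℝ
  | Sum.inl i => X i
  | Sum.inr i => √lam • Pi.single i 1

lemma sq_extendedRow_dotProduct_le {m N : ℕ} (X : Matrix (Fin m) (Fin N) ℝ) {lam : ℝ}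
    (hlam : 0 < lam) (j : Fin m ⊕ Fin N) (y : Fin N → ℝ) :
    (extendedRow X lam j ⬝ᵥ y) ^ 2
      ≤ y ⬝ᵥ ((Xᵀ * X + lam • (1 : Matrix (Fin N) (Fin N) ℝ)) *ᵥ y) := by
  rw [dotProduct_hessian_mulVec]
  have hnn {n : ℕ} (z : Fin n → ℝ) : 0 ≤ z ⬝ᵥ z := Finset.sum_nonneg fun i _ => mul_self_nonneg _
  have h1 := hnn (X *ᵥ y)
  have h2 := mul_nonneg hlam.le (hnn y)
  rcases j with i | i
  · refine le_add_of_le_of_nonneg ?_ h2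
    rw [sq]
    exact Finset.single_le_sum (f := fun k => (X *ᵥ y) k * (X *ᵥ y) k)
      (fun k _ => mul_self_nonneg _) (Finset.mem_univ i)
  · refine le_add_of_nonneg_of_le h1 ?_
    have : y i * y i ≤ y ⬝ᵥ y := Finset.single_le_sum (f := fun k => y k * y k)
      (fun k _ => mul_self_nonneg _) (Finset.mem_univ i)
    simp only [extendedRow, smul_dotProduct, single_dotProduct, one_mul,
      smul_eq_mul, mul_pow, Real.sq_sqrt hlam.le]
    rw [sq]
    gcongr

/-- The output `q` for the column `w` satisfies both sup-norm error bounds at the deviation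
`δ √(2 π r)`. -/
def ColumnBound {m N : ℕ} (X : Matrix (Fin m) (Fin N) ℝ) (lam δ r : ℝ) (w q : Fin N → ℝ) : Prop :=
  ‖X *ᵥ w - X *ᵥ q‖ ≤ δ * √(2 * Real.pi * r) * CInf X lam ∧
    ‖w - q‖ ≤ δ * √(2 * Real.pi * r) * (CInf X lam / √lam)

lemma columnBound_of_extendedRow {m N : ℕ} (X : Matrix (Fin m) (Fin N) ℝ) {lam δ : ℝ}
    (hlam : 0 < lam) (hδ : 0 < δ) (r : ℝ) {w q : Fin N → ℝ}
    (h : ∀ j, |extendedRow X lam j ⬝ᵥ (q - w)| ≤ δ * √(2 * Real.pi * r) * CInf X lam) :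
    ColumnBound X lam δ r w q := by
  have hC := CInf_pos X hlam
  refine ⟨(pi_norm_le_iff_of_nonneg (by positivity)).2 fun i => ?_,
    (pi_norm_le_iff_of_nonneg (by positivity)).2 fun i => ?_⟩
  · rw [← mulVec_sub, ← neg_sub q w, mulVec_neg, Pi.neg_apply, norm_neg, Real.norm_eq_abs]
    exact h (Sum.inl i)
  · have := h (Sum.inr i)
    simp only [extendedRow, smul_dotProduct, single_dotProduct, one_mul, smul_eq_mul,
      abs_mul, abs_of_pos (Real.sqrt_pos.2 hlam), Pi.sub_apply] at this
    rw [Pi.sub_apply, Real.norm_eq_abs, abs_sub_comm, ← mul_div_assoc,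
      le_div_iff₀ (Real.sqrt_pos.2 hlam), mul_comm]
    exact this

lemma measurableSet_columnBound {m N : ℕ} (X : Matrix (Fin m) (Fin N) ℝ) (lam δ r : ℝ)
    (w : Fin N → ℝ) : MeasurableSet {q | ColumnBound X lam δ r w q} := by
  have h1 : Continuous fun q : Fin N → ℝ => ‖X *ᵥ w - X *ᵥ q‖ := by fun_prop
  have h2 : Continuous fun q : Fin N → ℝ => ‖w - q‖ := by fun_prop
  exact (measurableSet_le h1.measurable measurable_const).inter
    (measurableSet_le h2.measurable measurable_const)

/-- The union bound over the `m + N` rows of the extended matrix and both signs. -/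
lemma optqColumn_not_columnBound_le {m N : ℕ} (X : Matrix (Fin m) (Fin N) ℝ) {lam δ r : ℝ}
    (hlam : 0 < lam) (hδ : 0 < δ) (hr : 0 ≤ r) (w : Fin N → ℝ) :
    (optqColumn X lam δ w).toMeasure {q | ¬ ColumnBound X lam δ r w q}
      ≤ ENNReal.ofReal (((m : ℝ) + N) * (2 * Real.exp (-(4 * Real.pi * r)))) := by
  have hL := optqFactor_spec X hlam
  set s := δ * √(2 * Real.pi * r) * CInf X lam with hs
  set e := Real.exp (-(4 * Real.pi * r)) with he
  have htail (g : Fin N → ℝ) (hg : (g ᵥ* optqFactor X lam) ⬝ᵥ (g ᵥ* optqFactor X lam) ≤ 1) :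
      (optqColumn X lam δ w).toMeasure {q | s < g ⬝ᵥ (q - w)} ≤ ENNReal.ofReal e :=
    optqState_tail hL.lower hL.diag_pos hδ w g (CInf_pos X hlam) (sq_inv_diag_le_CInf X hlam) hg hr
  have hrow (j) := vecMul_dotProduct_self_le_one (hessian_posDef X hlam) hL
    (sq_extendedRow_dotProduct_le X hlam j)
  have hsub : {q | ¬ ColumnBound X lam δ r w q} ⊆ ⋃ j : Fin m ⊕ Fin N,
      ({q | s < extendedRow X lam j ⬝ᵥ (q - w)} ∪ {q | s < (-extendedRow X lam j) ⬝ᵥ (q - w)}) := by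
    intro q hq
    by_contra hcon
    refine hq (columnBound_of_extendedRow X hlam hδ r fun j => ?_)
    simp only [Set.mem_iUnion, Set.mem_union, Set.mem_ofPred_eq, not_exists, not_or, not_lt,
      neg_dotProduct] at hcon
    exact abs_le'.2 (hcon j)
  calc _ ≤ ∑ j : Fin m ⊕ Fin N, (optqColumn X lam δ w).toMeasure
          ({q | s < extendedRow X lam j ⬝ᵥ (q - w)}
            ∪ {q | s < (-extendedRow X lam j) ⬝ᵥ (q - w)}) :=
        (measure_mono hsub).trans (measure_iUnion_fintype_le _ _)
    _ ≤ ∑ _j : Fin m ⊕ Fin N, ENNReal.ofReal (2 * e) := by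
        refine Finset.sum_le_sum fun j _ => (measure_union_le _ _).trans ?_
        rw [two_mul, ENNReal.ofReal_add (Real.exp_pos _).le (Real.exp_pos _).le]
        refine add_le_add (htail _ (hrow j)) (htail _ ?_)
        rw [neg_vecMul, neg_dotProduct_neg]
        exact hrow j
    _ = _ := by
        rw [Finset.sum_const, nsmul_eq_mul, ENNReal.ofReal_mul (by positivity : (0:ℝ) ≤ m + N)]
        simp [ENNReal.ofReal_add]

/-! ### Tail bounds for all columns -/

lemma optqLayer_not_columnBound_le {m N N' : ℕ} (X : Matrix (Fin m) (Fin N) ℝ) {lam δ r : ℝ}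
    (hlam : 0 < lam) (hδ : 0 < δ) (hr : 0 ≤ r) (W : Matrix (Fin N) (Fin N') ℝ) (k : Fin N') :
    optqLayer X lam δ W {c | ¬ ColumnBound X lam δ r (fun i => W i k) (c k)}
      ≤ ENNReal.ofReal (((m : ℝ) + N) * (2 * Real.exp (-(4 * Real.pi * r)))) := by
  refine le_of_eq_of_le ?_ (optqColumn_not_columnBound_le X hlam hδ hr fun i => W i k)
  exact (measurePreserving_eval (fun k => (optqColumn X lam δ fun i => W i k).toMeasure) k
    ).measure_preimage (measurableSet_columnBound X lam δ r _).compl.nullMeasurableSet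

/-- The sub-Gaussian tail `2 exp (-4 π r)` is smaller than `√2 exp (-r)` unless the latter is at
least one, in which case the lower bound for the probability is trivial. -/
lemma le_measureReal_of_compl_le {Ω : Type*} [MeasurableSpace Ω] (μ : Measure Ω)
    [IsProbabilityMeasure μ] {S : Set Ω} {M r : ℝ} (hM : 1 ≤ M) (hr : 0 ≤ r)
    (h : μ Sᶜ ≤ ENNReal.ofReal (M * (2 * Real.exp (-(4 * Real.pi * r))))) :
    1 - √2 * M * Real.exp (-r) ≤ μ.real S := by
  set x := Real.exp (-r) with hx
  have hx0 : 0 < x := Real.exp_pos _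
  have h2 : √2 ^ 2 = (2 : ℝ) := Real.sq_sqrt (by norm_num)
  have hs2 : 0 < √2 := by positivity
  by_cases hxs : 1 ≤ √2 * x
  · have : 1 ≤ √2 * M * x := by nlinarith
    linarith [measureReal_nonneg (μ := μ) (s := S)]
  push Not at hxs
  have h1 : 1 ≤ μ.real S + μ.real Sᶜ := by
    have := measureReal_union_le (μ := μ) S Sᶜ
    rwa [Set.union_compl_self, probReal_univ] at this
  have hS : μ.real Sᶜ ≤ M * (2 * Real.exp (-(4 * Real.pi * r))) :=
    ENNReal.toReal_le_of_le_ofReal (by positivity) h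
  have hexp : Real.exp (-(4 * Real.pi * r)) ≤ x ^ 2 := by
    rw [hx, ← Real.exp_nat_mul]
    refine Real.exp_le_exp.2 ?_
    push_cast
    nlinarith [Real.pi_gt_three]
  have hx2 : 2 * x ^ 2 ≤ √2 * x := by
    calc 2 * x ^ 2 = (√2 * x) * (√2 * x) := by linear_combination (-x ^ 2) * h2
      _ ≤ 1 * (√2 * x) := by gcongr
      _ = √2 * x := one_mul _
  have : M * (2 * Real.exp (-(4 * Real.pi * r))) ≤ M * (√2 * x) := by
    exact mul_le_mul_of_nonneg_left (by linarith) (by linarith)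
  linarith

end OPTQ

theorem mainTheorem2 {m N N' : ℕ} (hN : 0 < N) (hN' : 0 < N')
    (X : Matrix (Fin m) (Fin N) ℝ) (W : Matrix (Fin N) (Fin N') ℝ)
    (lam δ : ℝ) (hlam : 0 < lam) (hδ : 0 < δ) (p p' : ℝ) (hp : 0 < p) (hp' : 0 < p') :
    (∀ k : Fin N',
      1 - √2 * ((m : ℝ) + N) / (N : ℝ) ^ p ≤
        (OPTQ.optqLayer X lam δ W).real {c |
          ‖X *ᵥ (fun i => W i k) - X *ᵥ c k‖
              ≤ δ * √(2 * Real.pi * (p * Real.log N)) * OPTQ.CInf X lam ∧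
          ‖(fun i => W i k) - c k‖
              ≤ δ * √(2 * Real.pi * (p * Real.log N)) * (OPTQ.CInf X lam / √lam)}) ∧
    1 - √2 * ((m : ℝ) + N) / ((N : ℝ) ^ p * (N' : ℝ) ^ (p' - 1)) ≤
      (OPTQ.optqLayer X lam δ W).real {c |
        (∀ i k, |(X * W - X * OPTQ.ofColumns c) i k|
            ≤ δ * √(2 * Real.pi * (p * Real.log N + p' * Real.log N')) * OPTQ.CInf X lam) ∧
        (∀ i k, |(W - OPTQ.ofColumns c) i k|
            ≤ δ * √(2 * Real.pi * (p * Real.log N + p' * Real.log N'))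
              * (OPTQ.CInf X lam / √lam))} := by
  have hN1 : (1 : ℝ) ≤ N := by exact_mod_cast hN
  have hN1' : (1 : ℝ) ≤ N' := by exact_mod_cast hN'
  have hM : (1 : ℝ) ≤ m + N := by
    have : (0 : ℝ) ≤ m := m.cast_nonneg
    linarith
  have hr := mul_nonneg hp.le (Real.log_nonneg hN1)
  have hr' := mul_nonneg hp'.le (Real.log_nonneg hN1')
  have hNp : (N : ℝ) ^ p = Real.exp (p * Real.log N) := by
    rw [Real.rpow_def_of_pos (by linarith), mul_comm]
  have hNp' : (N' : ℝ) ^ (p' - 1) = Real.exp (p' * Real.log N') / N' := by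
    rw [Real.rpow_sub_one (by linarith), Real.rpow_def_of_pos (by linarith), mul_comm]
  constructor
  · intro k
    rw [hNp, div_eq_mul_inv, ← Real.exp_neg]
    exact OPTQ.le_measureReal_of_compl_le _ hM hr
      (OPTQ.optqLayer_not_columnBound_le X hlam hδ hr W k)
  · set r := p * Real.log N + p' * Real.log N' with hrdef
    have hr0 : 0 ≤ r := add_nonneg hr hr'
    have hval : √2 * ((m : ℝ) + N) / ((N : ℝ) ^ p * (N' : ℝ) ^ (p' - 1))
        = √2 * (N' * ((m : ℝ) + N)) * Real.exp (-r) := by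
      rw [hNp, hNp', hrdef, Real.exp_neg, Real.exp_add]
      field_simp
    rw [hval]
    refine OPTQ.le_measureReal_of_compl_le _ (by nlinarith) hr0 ?_
    have hsub : {c : Fin N' → Fin N → ℝ |
        (∀ i k, |(X * W - X * OPTQ.ofColumns c) i k|
            ≤ δ * √(2 * Real.pi * r) * OPTQ.CInf X lam) ∧
        (∀ i k, |(W - OPTQ.ofColumns c) i k|
            ≤ δ * √(2 * Real.pi * r) * (OPTQ.CInf X lam / √lam))}ᶜ
        ⊆ ⋃ k : Fin N', {c | ¬ OPTQ.ColumnBound X lam δ r (fun i => W i k) (c k)} := by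
      intro c hc
      by_contra hcon
      simp only [Set.mem_iUnion, Set.mem_ofPred_eq, not_exists, not_not] at hcon
      exact hc ⟨fun i k => (norm_le_pi_norm (X *ᵥ (fun i => W i k) - X *ᵥ c k) i).trans (hcon k).1,
        fun i k => (norm_le_pi_norm ((fun i => W i k) - c k) i).trans (hcon k).2⟩
    calc _ ≤ ∑ k : Fin N', OPTQ.optqLayer X lam δ W
              {c | ¬ OPTQ.ColumnBound X lam δ r (fun i => W i k) (c k)} :=
          (measure_mono hsub).trans (measure_iUnion_fintype_le _ _)
      _ ≤ ∑ _k : Fin N',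
              ENNReal.ofReal (((m : ℝ) + N) * (2 * Real.exp (-(4 * Real.pi * r)))) :=
          Finset.sum_le_sum fun k _ => OPTQ.optqLayer_not_columnBound_le X hlam hδ hr0 W k
      _ = _ := by
          rw [Finset.sum_const, nsmul_eq_mul, mul_assoc (N' : ℝ),
            ENNReal.ofReal_mul (by positivity : (0 : ℝ) ≤ N')]
          simp
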